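/- Let $M$ be a compact metric space and let $T$ be a total order on the set $M$ (no compatibility with the metric is assumed). For subsets $U_1,U_2\subseteq M$ and an integer $s\ge 0$, say that the ordered pair $(U_1,U_2)$ contains a snake of length $s$ if there are points $a_0<_T a_1<_T\dots<_T a_s$ of $M$ such that $a_i\in U_1$ for all even $i$ and $a_i\in U_2$ for all odd $i$. For distinct points $x,y\in M$ let $\mathrm{Snake}_T(x,y)\in\{0,1,2,\dots\}\cup\{\infty\}$ be the greatest $s$ such that for every $\varepsilon>0$ the pair of open balls $(B_\varepsilon(x),B_\varepsilon(y))$ contains a snake of length $s$, and $\infty$ if there is no greatest such $s$. Put $\mathrm{Snake}(M,T)=\sup_{x\ne y}\mathrm{Snake}_T(x,y)$, where the supremum over the empty set is $0$. **Theorem.** Let $s\ge 0$ be an integer. If $\mathrm{Snake}(M,T)\le s$, then $\dim M\le s$, where $\dim$ is the Lebesgue covering dimension; that is, every finite open cover of $M$ has a finite open refinement (again covering $M$) in which no $s+2$ distinct members have a common point. -/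

import Mathlib

/-- The ordered pair `(U₁, U₂)` of subsets of `M` contains a snake of length `s` for the total
order `T`: there are points `a 0 <_T a 1 <_T ⋯ <_T a s` whose even-indexed members lie in `U₁`
and whose odd-indexed members lie in `U₂`. -/
def ContainsSnake {M : Type*} (T : LinearOrder M) (U₁ U₂ : Set M) (s : ℕ) : Prop :=
  ∃ a : Fin (s + 1) → M,
    (∀ i j : Fin (s + 1), i < j → T.lt (a i) (a j)) ∧
    (∀ i : Fin (s + 1), Even (i : ℕ) → a i ∈ U₁) ∧
    (∀ i : Fin (s + 1), Odd (i : ℕ) → a i ∈ U₂)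

/-- The snake number of a pair of points: the greatest `s` such that for every `ε > 0` the pair
of open balls `(B_ε(x), B_ε(y))` contains a snake of length `s`, and `⊤` if there is no greatest
such `s`. -/
noncomputable def pairSnakeNumber {M : Type*} [MetricSpace M] (T : LinearOrder M) (x y : M) : ℕ∞ :=
  ⨆ (s : ℕ) (_ : ∀ ε : ℝ, 0 < ε → ContainsSnake T (Metric.ball x ε) (Metric.ball y ε) s), (s : ℕ∞)

/-- The snake number of the ordered metric space `(M, T)`: the supremum of the snake numbers of
the ordered pairs of distinct points. -/
noncomputable def snakeNumber (M : Type*) [MetricSpace M] (T : LinearOrder M) : ℕ∞ :=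
  ⨆ (x : M) (y : M) (_ : x ≠ y), pairSnakeNumber T x y

/-- The order of a family of subsets of `X`: the largest integer `n` such that the family
contains `n + 1` (distinct) sets with a non-empty intersection. It is `⊥` (standing for `-1`)
if the family has no non-empty member, and `⊤` if there is no largest such `n`. -/
noncomputable def familyOrder {X : Type*} (A : Set (Set X)) : WithBot ℕ∞ :=
  ⨆ (n : ℕ) (_ : ∃ F : Finset (Set X),
      (F : Set (Set X)) ⊆ A ∧ F.card = n + 1 ∧ (⋂₀ (F : Set (Set X))).Nonempty), (n : WithBot ℕ∞)

/-- `A` is a finite open cover of `X`. -/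
def IsFiniteOpenCover {X : Type*} [TopologicalSpace X] (A : Set (Set X)) : Prop :=
  A.Finite ∧ (∀ U ∈ A, IsOpen U) ∧ ⋃₀ A = Set.univ

/-- Every finite open cover of `X` has a finite open refinement (again a cover of `X`) of
order at most `n`. -/
def HasCoveringDimLE (X : Type*) [TopologicalSpace X] (n : WithBot ℕ∞) : Prop :=
  ∀ A : Set (Set X), IsFiniteOpenCover A →
    ∃ B : Set (Set X), IsFiniteOpenCover B ∧ (∀ V ∈ B, ∃ U ∈ A, V ⊆ U) ∧ familyOrder B ≤ n

/-- The covering dimension of `X`, with values in `{-1, 0, 1, …, ∞}`, where `-1` is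
written `⊥`. -/
noncomputable def coveringDim (X : Type*) [TopologicalSpace X] : WithBot ℕ∞ :=
  sInf {n : WithBot ℕ∞ | HasCoveringDimLE X n}

/-- The infimum in the definition of the covering dimension is attained. -/
theorem coveringDim_le_iff (X : Type*) [TopologicalSpace X] (n : WithBot ℕ∞) :
    coveringDim X ≤ n ↔ HasCoveringDimLE X n := by
  constructor
  · intro h A hA
    have hne : {n : WithBot ℕ∞ | HasCoveringDimLE X n}.Nonempty :=
      ⟨⊤, fun A hA => ⟨A, hA, fun V hV => ⟨V, hV, subset_rfl⟩, le_top⟩⟩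
    obtain ⟨B, h1, h2, h3⟩ := csInf_mem hne A hA
    exact ⟨B, h1, h2, h3.trans h⟩
  · intro h
    exact sInf_le h

open Set Topology

universe u

/-! The proof is by induction on the length of alternating chains, for a closed set `C` and a set
`L` whose closure contains `C`; only chains in `L` are counted. Two sets are needed because the
order ignores the topology, so a cut of `L` need not induce a useful cut of `C`. Given `x ≠ y` in
`C`, grade `L` by the longest alternating chain lying below each point. Points of even grade avoid a
neighbourhood of `x`, points of odd grade one of `y`, so the closures of the two halves separate `x`
from `y` (`exists_separation_of_altReach_eq_empty`). They meet only over the boundaries of finitely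
many cuts of `L` by upper sets. Near such a boundary, a chain in the lower part extends by one point
of the upper part, so the lower part has shorter chains (`NoLongChain.boundary`) and the boundary
has smaller dimension by induction. As in inductive dimension, separating all pairs of points by
such sets raises the dimension by at most one (`CoverMultLE.succ_of_separation`). -/

/-- Every finite indexed family of open sets covering `A` has an open shrinking that still covers
`A` and in which every point of `A` lies in at most `n` members. For closed `A` in a normal space
this says that the covering dimension of `A` is less than `n`. -/
def CoverMultLE {X : Type u} [TopologicalSpace X] (A : Set X) (n : ℕ) : Prop :=
  ∀ (ι : Type u) [Finite ι] (U : ι → Set X), (∀ i, IsOpen (U i)) → A ⊆ ⋃ i, U i →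
    ∃ V : ι → Set X, (∀ i, IsOpen (V i)) ∧ (∀ i, V i ⊆ U i) ∧ A ⊆ ⋃ i, V i ∧
      ∀ x ∈ A, {i | x ∈ V i}.ncard ≤ n

/-! ### Covering dimension of subsets: monotonicity, sums, shrinkings -/

namespace CoverMultLE

section General

variable {X : Type u} [TopologicalSpace X] {A B : Set X} {n : ℕ}

theorem mono (hB : CoverMultLE B n) (hA : IsClosed A) (hAB : A ⊆ B) : CoverMultLE A n := by
  intro ι _ U hU hc
  obtain ⟨V, hV, hVU, hVc, hm⟩ := hB (Option ι) (fun o => o.elim Aᶜ U)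
    (by rintro (_ | i); exacts [hA.isOpen_compl, hU i])
    (by
      intro x hx
      by_cases hxA : x ∈ A
      · obtain ⟨i, hi⟩ := mem_iUnion.1 (hc hxA)
        exact mem_iUnion.2 ⟨some i, hi⟩
      · exact mem_iUnion.2 ⟨none, hxA⟩)
  refine ⟨fun i => V (some i), fun i => hV _, fun i => hVU (some i), ?_, ?_⟩
  · intro x hx
    obtain ⟨o, ho⟩ := mem_iUnion.1 (hVc (hAB hx))
    rcases o with _ | i
    · exact absurd hx (hVU none ho)
    · exact mem_iUnion.2 ⟨i, ho⟩
  · intro x hx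
    refine le_trans ?_ (hm x (hAB hx))
    rw [← ncard_image_of_injective _ (Option.some_injective ι)]
    exact ncard_le_ncard (by rintro _ ⟨i, hi, rfl⟩; exact hi) (toFinite _)

/-- The multiplicity on a closed set can be lowered without losing the rest of the cover. -/
theorem exists_shrinking (hA : CoverMultLE A n) (hAc : IsClosed A) {ι : Type u} [Finite ι]
    {U : ι → Set X} (hU : ∀ i, IsOpen (U i)) (hc : A ⊆ ⋃ i, U i) :
    ∃ V : ι → Set X, (∀ i, IsOpen (V i)) ∧ (∀ i, V i ⊆ U i) ∧ (⋃ i, U i) ⊆ ⋃ i, V i ∧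
      ∀ x ∈ A, {i | x ∈ V i}.ncard ≤ n := by
  obtain ⟨V, hV, hVU, hVc, hm⟩ := hA ι U hU hc
  refine ⟨fun i => V i ∪ (U i \ A), fun i => (hV i).union ((hU i).sdiff hAc),
    fun i => union_subset (hVU i) sdiff_subset, ?_, ?_⟩
  · intro x hx
    by_cases hxA : x ∈ A
    · obtain ⟨i, hi⟩ := mem_iUnion.1 (hVc hxA)
      exact mem_iUnion.2 ⟨i, Or.inl hi⟩
    · obtain ⟨i, hi⟩ := mem_iUnion.1 hx
      exact mem_iUnion.2 ⟨i, Or.inr ⟨hi, hxA⟩⟩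
  · intro x hx
    convert hm x hx using 3
    simp [hx]

/-- The finite closed sum theorem. -/
theorem union (hA : CoverMultLE A n) (hB : CoverMultLE B n) (hAc : IsClosed A)
    (hBc : IsClosed B) : CoverMultLE (A ∪ B) n := by
  intro ι _ U hU hc
  obtain ⟨V, hV, hVU, hVc, hmV⟩ := hA.exists_shrinking hAc hU (subset_union_left.trans hc)
  obtain ⟨W, hW, hWV, hWc, hmW⟩ :=
    hB.exists_shrinking hBc hV ((subset_union_right.trans hc).trans hVc)
  refine ⟨W, hW, fun i => (hWV i).trans (hVU i), hc.trans (hVc.trans hWc), ?_⟩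
  rintro x (hx | hx)
  · exact (ncard_le_ncard (fun i hi => hWV i hi) (toFinite _)).trans (hmV x hx)
  · exact hmW x hx

theorem empty : CoverMultLE (∅ : Set X) n := by
  intro ι _ U _ _
  exact ⟨fun _ => ∅, by simp, by simp, by simp, by simp⟩

theorem biUnion {κ : Type*} (s : Finset κ) {F : κ → Set X} (hF : ∀ k ∈ s, CoverMultLE (F k) n)
    (hc : ∀ k ∈ s, IsClosed (F k)) : CoverMultLE (⋃ k ∈ s, F k) n := by
  classical
  induction s using Finset.induction_on with
  | empty => simpa using empty
  | insert k s _ ih =>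
    rw [Finset.set_biUnion_insert]
    exact (hF k (s.mem_insert_self k)).union
      (ih (fun j hj => hF j (Finset.mem_insert_of_mem hj))
        (fun j hj => hc j (Finset.mem_insert_of_mem hj)))
      (hc k (s.mem_insert_self k))
      (isClosed_biUnion_finset fun j hj => hc j (Finset.mem_insert_of_mem hj))

theorem of_subsingleton (hA : A.Subsingleton) : CoverMultLE A 1 := by
  intro ι _ U hU hc
  rcases A.eq_empty_or_nonempty with rfl | ⟨x, hx⟩
  · exact empty ι U hU hc
  · obtain ⟨i, hi⟩ := mem_iUnion.1 (hc hx)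
    refine ⟨fun j => {y | j = i ∧ y ∈ U i}, fun j => ?_, ?_, ?_, ?_⟩
    · by_cases h : j = i
      · simpa [h] using hU i
      · simp [h]
    · rintro j y ⟨rfl, hy⟩
      exact hy
    · intro y hy
      rw [hA hy hx]
      exact mem_iUnion.2 ⟨i, rfl, hi⟩
    · intro y _
      refine (ncard_le_ncard (t := {i}) ?_ (toFinite _)).trans (ncard_singleton i).le
      rintro j ⟨rfl, _⟩
      rfl

end General

section Normal

variable {X : Type u} [TopologicalSpace X] [NormalSpace X] {A C : Set X} {n : ℕ}

/-- In a normal space the multiplicity bound can be achieved at all points of the space. -/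
theorem exists_shrinking_forall (hA : CoverMultLE A n) (hAc : IsClosed A) {ι : Type u} [Finite ι]
    {U : ι → Set X} (hU : ∀ i, IsOpen (U i)) (hc : A ⊆ ⋃ i, U i) :
    ∃ V : ι → Set X, (∀ i, IsOpen (V i)) ∧ (∀ i, V i ⊆ U i) ∧ A ⊆ ⋃ i, V i ∧
      ∀ x, {i | x ∈ V i}.ncard ≤ n := by
  obtain ⟨V, hV, hVU, hVc, hm⟩ := hA ι U hU hc
  obtain ⟨W, hWc, hW, hWV⟩ := exists_subset_iUnion_closure_subset hAc hV
    (fun x _ => toFinite _) hVc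
  -- Passing to closures makes the set of low multiplicity open; it still contains `A`, since the
  -- closures lie in the `V i`.
  let O : Set X := {x | {i | x ∈ closure (W i)}.ncard ≤ n}
  have hO : IsOpen O := by
    have hO' : Oᶜ = ⋃ S ∈ {S : Set ι | n < S.ncard}, ⋂ i ∈ S, closure (W i) := by
      ext x
      simp only [O, mem_compl_iff, mem_ofPred_eq, not_le, mem_iUnion, mem_iInter, exists_prop]
      constructor
      · intro h
        exact ⟨_, h, fun i hi => hi⟩
      · rintro ⟨S, hS, hx⟩
        exact hS.trans_le (ncard_le_ncard (fun i hi => hx i hi) (toFinite _))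
    rw [← isClosed_compl_iff, hO']
    exact (toFinite _).isClosed_biUnion fun S _ => isClosed_biInter fun i _ => isClosed_closure
  refine ⟨fun i => W i ∩ O, fun i => (hW i).inter hO,
    fun i => inter_subset_left.trans (subset_closure.trans ((hWV i).trans (hVU i))), ?_, ?_⟩
  · intro x hx
    obtain ⟨i, hi⟩ := mem_iUnion.1 (hWc hx)
    exact mem_iUnion.2 ⟨i, hi,
      (ncard_le_ncard (fun j hj => hWV j hj) (toFinite _)).trans (hm x hx)⟩
  · intro x
    by_cases hx : x ∈ O
    · refine (ncard_le_ncard (t := {i | x ∈ closure (W i)}) ?_ (toFinite _)).trans hx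
      exact fun i hi => subset_closure hi.1
    · simp [hx]

end Normal

end CoverMultLE

/-! ### Raising the dimension by one -/

/-- Finitely many pairwise disjoint closed sets have pairwise disjoint open neighbourhoods inside
prescribed neighbourhoods. -/
theorem exists_pairwise_disjoint_open_superset {X ι : Type*} [TopologicalSpace X] [NormalSpace X]
    [Finite ι] {E U : ι → Set X} (hE : ∀ i, IsClosed (E i)) (hU : ∀ i, IsOpen (U i))
    (hEU : ∀ i, E i ⊆ U i) (hd : Pairwise fun i j => Disjoint (E i) (E j)) :
    ∃ W : ι → Set X, (∀ i, IsOpen (W i)) ∧ (∀ i, E i ⊆ W i) ∧ (∀ i, W i ⊆ U i) ∧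
      Pairwise fun i j => Disjoint (W i) (W j) := by
  have key : ∀ i, ∃ G : Set X, IsOpen G ∧ E i ⊆ G ∧
      closure G ⊆ (⋃ j ∈ {j | j ≠ i}, E j)ᶜ := by
    intro i
    refine normal_exists_closure_subset (hE i)
      ((toFinite _).isClosed_biUnion fun j _ => hE j).isOpen_compl ?_
    intro x hx hx'
    obtain ⟨j, hj, hxj⟩ := mem_iUnion₂.1 hx'
    exact (hd hj).le_bot ⟨hxj, hx⟩
  choose G hG hEG hGc using key
  refine ⟨fun i => (G i ∩ U i) \ ⋃ j ∈ {j | j ≠ i}, closure (G j), fun i => ?_, fun i x hx => ?_,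
    fun i x hx => hx.1.2, fun i j hij => ?_⟩
  · exact ((hG i).inter (hU i)).sdiff ((toFinite _).isClosed_biUnion fun j _ => isClosed_closure)
  · refine ⟨⟨hEG i hx, hEU i hx⟩, fun hx' => ?_⟩
    obtain ⟨j, hj, hxj⟩ := mem_iUnion₂.1 hx'
    exact hGc j hxj (mem_iUnion₂.2 ⟨i, Ne.symm hj, hx⟩)
  · refine Set.disjoint_left.2 fun x hx hx' => ?_
    exact hx'.2 (mem_iUnion₂.2 ⟨i, hij, subset_closure hx.1.1⟩)

namespace CoverMultLE

variable {X : Type u} [TopologicalSpace X] {C : Set X} {n : ℕ}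

/-- If every finite open cover of `C` is refined by a closed cover whose members pairwise
intersect in a set of smaller dimension, the dimension of `C` grows by at most one. -/
theorem succ_of_closed_cover [NormalSpace X]
    (h : ∀ (ι : Type u) [Finite ι] (U : ι → Set X), (∀ i, IsOpen (U i)) → C ⊆ ⋃ i, U i →
      ∃ (E : ι → Set X) (Z : Set X), (∀ i, IsClosed (E i)) ∧ (∀ i, E i ⊆ U i) ∧ C ⊆ ⋃ i, E i ∧
        IsClosed Z ∧ Z ⊆ C ∧ CoverMultLE Z n ∧ Pairwise fun i j => E i ∩ E j ⊆ Z) :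
    CoverMultLE C (n + 1) := by
  intro ι _ U hU hc
  obtain ⟨E, Z, hE, hEU, hEc, hZ, hZC, hZn, hEZ⟩ := h ι U hU hc
  obtain ⟨V, hV, hVU, hVc, hm⟩ := hZn.exists_shrinking_forall hZ hU (hZC.trans hc)
  -- The `V j` cover `Z`, so outside them the `E i` are disjoint and can be swollen to disjoint open
  -- sets, adding at most one to the multiplicity.
  obtain ⟨W, hW, hEW, hWU, hWd⟩ := exists_pairwise_disjoint_open_superset
    (E := fun i => E i \ ⋃ j, V j) (U := U)
    (fun i => (hE i).sdiff (isOpen_iUnion hV)) hU (fun i => sdiff_subset.trans (hEU i))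
    (fun i j hij => Set.disjoint_left.2 fun x hx hx' => hx.2 (hVc (hEZ hij ⟨hx.1, hx'.1⟩)))
  refine ⟨fun i => V i ∪ W i, fun i => (hV i).union (hW i),
    fun i => union_subset (hVU i) (hWU i), ?_, ?_⟩
  · intro x hx
    by_cases hxV : x ∈ ⋃ j, V j
    · obtain ⟨i, hi⟩ := mem_iUnion.1 hxV
      exact mem_iUnion.2 ⟨i, Or.inl hi⟩
    · obtain ⟨i, hi⟩ := mem_iUnion.1 (hEc hx)
      exact mem_iUnion.2 ⟨i, Or.inr (hEW i ⟨hi, hxV⟩)⟩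
  · intro x _
    have h1 : {i | x ∈ W i}.ncard ≤ 1 := by
      refine (ncard_le_one (toFinite _)).2 fun i hi j hj => ?_
      by_contra hij
      exact (hWd hij).le_bot ⟨hi, hj⟩
    exact (ncard_union_le {i | x ∈ V i} {i | x ∈ W i}).trans (add_le_add (hm x) h1)

/-- If any two distinct points of the compact set `C` are separated by a closed subset of smaller
dimension, the dimension of `C` grows by at most one. -/
theorem succ_of_separation [T2Space X] [NormalSpace X] (hC : IsCompact C)
    (h : ∀ x ∈ C, ∀ y ∈ C, x ≠ y → ∃ R B : Set X, IsClosed R ∧ IsClosed B ∧ R ∪ B = C ∧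
      x ∉ B ∧ y ∉ R ∧ CoverMultLE (R ∩ B) n) :
    CoverMultLE C (n + 1) := by
  -- By compactness of `K`, finitely many separations suffice: intersect the sets `R` and unite the
  -- sets `B`.
  have sep : ∀ x ∈ C, ∀ K ⊆ C, IsCompact K → x ∉ K → ∃ R B : Set X, IsClosed R ∧ IsClosed B ∧
      R ∪ B = C ∧ x ∉ B ∧ Disjoint K R ∧ CoverMultLE (R ∩ B) n := by
    intro x hx K hKC hK hxK
    refine hK.induction_on (p := fun K => ∃ R B : Set X, IsClosed R ∧ IsClosed B ∧
      R ∪ B = C ∧ x ∉ B ∧ Disjoint K R ∧ CoverMultLE (R ∩ B) n) ?_ ?_ ?_ ?_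
    · exact ⟨C, ∅, hC.isClosed, isClosed_empty, by simp, by simp, by simp, by simpa using empty⟩
    · rintro s t hst ⟨R, B, h1, h2, h3, h4, h5, h6⟩
      exact ⟨R, B, h1, h2, h3, h4, h5.mono_left hst, h6⟩
    · rintro s t ⟨R, B, h1, h2, h3, h4, h5, h6⟩ ⟨R', B', h1', h2', h3', h4', h5', h6'⟩
      refine ⟨R ∩ R', B ∪ B', h1.inter h1', h2.union h2', ?_, by simp [h4, h4'], ?_, ?_⟩
      · ext z
        have e1 := Set.ext_iff.1 h3 z
        have e2 := Set.ext_iff.1 h3' z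
        simp only [mem_union, mem_inter_iff] at *
        tauto
      · rw [disjoint_union_left]
        exact ⟨h5.mono_right inter_subset_left, h5'.mono_right inter_subset_right⟩
      · refine (h6.union h6' (h1.inter h2) (h1'.inter h2')).mono
          ((h1.inter h1').inter (h2.union h2')) ?_
        rintro z ⟨⟨hz1, hz2⟩, hz | hz⟩
        · exact Or.inl ⟨hz1, hz⟩
        · exact Or.inr ⟨hz2, hz⟩
    · intro y hy
      obtain ⟨R, B, h1, h2, h3, h4, h5, h6⟩ :=
        h x hx y (hKC hy) (by rintro rfl; exact hxK hy)
      exact ⟨Rᶜ, mem_nhdsWithin_of_mem_nhds (h1.isOpen_compl.mem_nhds h5), R, B, h1, h2, h3, h4,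
        disjoint_compl_left, h6⟩
  refine succ_of_closed_cover fun ι _ U hU hc => ?_
  classical
  -- `B` is the part of `C` not yet carved into the `E i`. When two carvings are combined, the
  -- second is restricted to the remainder of the first; `E i ∩ B ⊆ Z` then keeps the new overlaps
  -- inside `Z ∪ Z'`.
  have main : ∃ (E : ι → Set X) (B Z : Set X), (∀ i, IsClosed (E i)) ∧ (∀ i, E i ⊆ U i) ∧
      IsClosed B ∧ B ⊆ C ∧ Disjoint C B ∧ C ⊆ (⋃ i, E i) ∪ B ∧ IsClosed Z ∧ Z ⊆ C ∧
      CoverMultLE Z n ∧ (Pairwise fun i j => E i ∩ E j ⊆ Z) ∧ ∀ i, E i ∩ B ⊆ Z := by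
    refine hC.induction_on (p := fun S => ∃ (E : ι → Set X) (B Z : Set X),
      (∀ i, IsClosed (E i)) ∧ (∀ i, E i ⊆ U i) ∧
      IsClosed B ∧ B ⊆ C ∧ Disjoint S B ∧ C ⊆ (⋃ i, E i) ∪ B ∧ IsClosed Z ∧ Z ⊆ C ∧
      CoverMultLE Z n ∧ (Pairwise fun i j => E i ∩ E j ⊆ Z) ∧ ∀ i, E i ∩ B ⊆ Z) ?_ ?_ ?_ ?_
    · exact ⟨fun _ => ∅, C, ∅, by simp, by simp, hC.isClosed, subset_rfl, by simp, by simp,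
        by simp, by simp, empty, fun i j _ => by simp, by simp⟩
    · rintro s t hst ⟨E, B, Z, h1, h2, h3, h4, h5, h6⟩
      exact ⟨E, B, Z, h1, h2, h3, h4, h5.mono_left hst, h6⟩
    · rintro s t ⟨E, B, Z, h1, h2, h3, h4, h5, h6, h7, h8, h9, h10, h11⟩
        ⟨E', B', Z', h1', h2', h3', h4', h5', h6', h7', h8', h9', h10', h11'⟩
      refine ⟨fun i => E i ∪ (E' i ∩ B), B ∩ B', Z ∪ Z',
        fun i => (h1 i).union ((h1' i).inter h3),
        fun i => union_subset (h2 i) (inter_subset_left.trans (h2' i)), h3.inter h3',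
        inter_subset_left.trans h4, ?_, ?_, h7.union h7', union_subset h8 h8',
        h9.union h9' h7 h7', fun i j hij => ?_, fun i => ?_⟩
      · rw [disjoint_union_left]
        exact ⟨h5.mono_right inter_subset_left, h5'.mono_right inter_subset_right⟩
      · intro x hx
        rcases h6 hx with hx1 | hx1
        · obtain ⟨i, hi⟩ := mem_iUnion.1 hx1
          exact Or.inl (mem_iUnion.2 ⟨i, Or.inl hi⟩)
        · rcases h6' hx with hx2 | hx2
          · obtain ⟨i, hi⟩ := mem_iUnion.1 hx2
            exact Or.inl (mem_iUnion.2 ⟨i, Or.inr ⟨hi, hx1⟩⟩)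
          · exact Or.inr ⟨hx1, hx2⟩
      · rintro x ⟨hx | hx, hx' | hx'⟩
        · exact Or.inl (h10 hij ⟨hx, hx'⟩)
        · exact Or.inl (h11 i ⟨hx, hx'.2⟩)
        · exact Or.inl (h11 j ⟨hx', hx.2⟩)
        · exact Or.inr (h10' hij ⟨hx.1, hx'.1⟩)
      · rintro x ⟨hx | hx, hx'⟩
        · exact Or.inl (h11 i ⟨hx, hx'.1⟩)
        · exact Or.inr (h11' i ⟨hx.1, hx'.2⟩)
    · intro x hx
      obtain ⟨i, hi⟩ := mem_iUnion.1 (hc hx)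
      obtain ⟨R, B, h1, h2, h3, h4, h5, h6⟩ := sep x hx (C \ U i) sdiff_subset
        (hC.diff (hU i)) (fun hx' => hx'.2 hi)
      have hRC : R ⊆ C := h3 ▸ subset_union_left
      have hE : ∀ j z, z ∈ (if j = i then R else ∅) → j = i ∧ z ∈ R := by
        intro j z hz
        split_ifs at hz with hj
        · exact ⟨hj, hz⟩
        · exact hz.elim
      refine ⟨Bᶜ, mem_nhdsWithin_of_mem_nhds (h2.isOpen_compl.mem_nhds h4),
        fun j => if j = i then R else ∅, B, R ∩ B, fun j => ?_, fun j z hz => ?_, h2,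
        h3 ▸ subset_union_right, disjoint_compl_left, ?_, h1.inter h2,
        inter_subset_left.trans hRC, h6, fun j k hjk => ?_, fun j z hz => ?_⟩
      · dsimp only
        split_ifs
        exacts [h1, isClosed_empty]
      · obtain ⟨rfl, hzR⟩ := hE j z hz
        by_contra hzU
        exact h5.le_bot ⟨⟨hRC hzR, hzU⟩, hzR⟩
      · rw [← h3]
        exact union_subset_union_left _ fun z hz => mem_iUnion.2 ⟨i, by simpa using hz⟩
      · rintro z ⟨hz, hz'⟩
        exact absurd ((hE j z hz).1.trans (hE k z hz').1.symm) hjk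
      · exact ⟨(hE j z hz.1).2, hz.2⟩
  obtain ⟨E, B, Z, h1, h2, h3, h4, h5, h6, h7, h8, h9, h10, -⟩ := main
  have hB : B = ∅ := by
    simpa using h5.mono_left h4
  exact ⟨E, Z, h1, h2, by simpa [hB] using h6, h7, h8, h9, h10⟩

end CoverMultLE

/-! ### Alternating chains and cuts -/

section Reach

variable {X : Type u} [LinearOrder X]

/-- The points lying above an alternating chain of `m` points that starts in `P` and alternates
between `P` and `Q`. -/
def altReach (P Q : Set X) : ℕ → Set X
  | 0 => univ
  | m + 1 => {z | ∃ a ∈ altReach P Q m, a ≤ z ∧ a ∈ if Even m then P else Q}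

variable {P Q P' Q' : Set X}

theorem isUpperSet_altReach (m : ℕ) : IsUpperSet (altReach P Q m) := by
  cases m with
  | zero => exact isUpperSet_univ
  | succ m =>
    rintro z w hzw ⟨a, ha, haz, h⟩
    exact ⟨a, ha, haz.trans hzw, h⟩

theorem altReach_succ_subset (m : ℕ) : altReach P Q (m + 1) ⊆ altReach P Q m := by
  rintro z ⟨a, ha, haz, _⟩
  exact isUpperSet_altReach m haz ha

theorem altReach_antitone : Antitone (altReach P Q) :=
  antitone_nat_of_succ_le altReach_succ_subset

theorem mem_altReach_succ {m : ℕ} {z : X} (hz : z ∈ altReach P Q m)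
    (h : z ∈ if Even m then P else Q) : z ∈ altReach P Q (m + 1) :=
  ⟨z, hz, le_rfl, h⟩

theorem altReach_mono (hP : P ⊆ P') (hQ : Q ⊆ Q') (m : ℕ) :
    altReach P Q m ⊆ altReach P' Q' m := by
  induction m with
  | zero => exact subset_rfl
  | succ m ih =>
    rintro z ⟨a, ha, haz, h⟩
    refine ⟨a, ih ha, haz, ?_⟩
    split_ifs at h ⊢
    exacts [hP h, hQ h]

/-- The steps in `altReach` are only weakly increasing; disjointness of `P` and `Q` makes them
strict. -/
theorem exists_chain_of_mem_altReach (hd : Disjoint P Q) {m : ℕ} {z : X}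
    (hz : z ∈ altReach P Q (m + 1)) :
    ∃ a : ℕ → X, (∀ i < m, a i < a (i + 1)) ∧ (∀ i ≤ m, a i ∈ if Even i then P else Q) ∧
      a m ≤ z := by
  induction m generalizing z with
  | zero =>
    obtain ⟨a, _, haz, h⟩ := hz
    exact ⟨fun _ => a, by simp, by simpa using h, haz⟩
  | succ m ih =>
    obtain ⟨b, hb, hbz, h⟩ := hz
    obtain ⟨a, ha, hPQ, hab⟩ := ih hb
    have hne : a m ≠ b := by
      intro he
      have h' := hPQ m le_rfl
      rw [he] at h'
      by_cases hm : Even m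
      · simp only [Nat.even_add_one, hm, not_true_eq_false, if_true, if_false] at h h'
        exact hd.le_bot ⟨h', h⟩
      · simp only [Nat.even_add_one, hm, not_false_eq_true, if_true, if_false] at h h'
        exact hd.le_bot ⟨h, h'⟩
    refine ⟨Function.update a (m + 1) b, fun i hi => ?_, fun i hi => ?_, by simpa using hbz⟩
    · rw [Function.update_of_ne (by omega)]
      rcases Nat.lt_succ_iff_lt_or_eq.1 hi with hi' | rfl
      · rw [Function.update_of_ne (by omega)]
        exact ha i hi'
      · rw [Function.update_self]
        exact lt_of_le_of_ne hab hne
    · rcases hi.eq_or_lt with rfl | hi'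
      · rwa [Function.update_self]
      · rw [Function.update_of_ne (by omega)]
        exact hPQ i (by omega)

variable [TopologicalSpace X]

/-- Distinct points of `C` have neighbourhoods whose traces on `L` admit no alternating chain of
`n` points. -/
def NoLongChain (C L : Set X) (n : ℕ) : Prop :=
  ∀ x ∈ C, ∀ y ∈ C, x ≠ y → ∃ u ∈ 𝓝 x, ∃ v ∈ 𝓝 y, altReach (L ∩ u) (L ∩ v) n = ∅

/-- Cutting `L` by an upper set shortens the chains near the common boundary of the two parts. -/
theorem NoLongChain.boundary {C L S : Set X} {n : ℕ} (h : NoLongChain C L (n + 2))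
    (hS : IsUpperSet S) :
    NoLongChain (C ∩ (closure (L \ S) ∩ closure (L ∩ S))) (L \ S) (n + 1) := by
  rintro x ⟨hxC, _, hxS⟩ y ⟨hyC, _, hyS⟩ hxy
  obtain ⟨u, hu, v, hv, huv⟩ := h x hxC y hyC hxy
  refine ⟨u, hu, v, hv, eq_empty_iff_forall_notMem.2 ?_⟩
  rintro z ⟨a, ha, _, haPQ⟩
  have haS : a ∉ S := by
    split_ifs at haPQ
    exacts [haPQ.1.2, haPQ.1.2]
  have ha' : a ∈ altReach (L ∩ u) (L ∩ v) (n + 1) := by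
    refine altReach_mono (P := (L \ S) ∩ u) (Q := (L \ S) ∩ v) ?_ ?_ _ (mem_altReach_succ ha haPQ)
    · exact inter_subset_inter_left _ sdiff_subset
    · exact inter_subset_inter_left _ sdiff_subset
  -- The parity decides whether the extra point must be near `x` or near `y`; both are limits of `L
  -- ∩ S`.
  obtain ⟨b, hbS, hb⟩ : ∃ b ∈ S, b ∈ if Even (n + 1) then L ∩ u else L ∩ v := by
    split_ifs
    · obtain ⟨b, hbu, hbL, hbS⟩ := mem_closure_iff_nhds.1 hxS u hu
      exact ⟨b, hbS, hbL, hbu⟩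
    · obtain ⟨b, hbv, hbL, hbS⟩ := mem_closure_iff_nhds.1 hyS v hv
      exact ⟨b, hbS, hbL, hbv⟩
  have hab : a ≤ b := le_of_not_ge fun hba => haS (hS hba hbS)
  have hb' := mem_altReach_succ (isUpperSet_altReach (n + 1) hab ha') hb
  rw [huv] at hb'
  exact hb'

/-- A point of `L` near `x` and one near `y` are comparable, so they form a two-point chain starting
at one end or the other. Hence neighbourhoods for both orders of the pair are intersected. -/
theorem NoLongChain.subsingleton [T2Space X] {C L : Set X} (h : NoLongChain C L 2)
    (hCL : C ⊆ closure L) : C.Subsingleton := by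
  intro x hx y hy
  by_contra hxy
  obtain ⟨u, hu, v, hv, huv⟩ := h x hx y hy hxy
  obtain ⟨u', hu', v', hv', huv'⟩ := h y hy x hx (Ne.symm hxy)
  obtain ⟨a, ⟨hau, hav⟩, haL⟩ := mem_closure_iff_nhds.1 (hCL hx) _ (Filter.inter_mem hu hv')
  obtain ⟨b, ⟨hbv, hbu⟩, hbL⟩ := mem_closure_iff_nhds.1 (hCL hy) _ (Filter.inter_mem hv hu')
  have key : ∀ {P Q : Set X} {c d : X}, c ∈ P → d ∈ Q → c ≤ d → d ∈ altReach P Q 2 := by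
    intro P Q c d hc hd hcd
    exact ⟨d, ⟨c, mem_univ c, hcd, by simpa using hc⟩, le_rfl, by simpa using hd⟩
  rcases le_total a b with hab | hba
  · exact (huv ▸ key (P := L ∩ u) (Q := L ∩ v) ⟨haL, hau⟩ ⟨hbL, hbv⟩ hab : b ∈ (∅ : Set X))
  · exact (huv' ▸ key (P := L ∩ u') (Q := L ∩ v') ⟨hbL, hbu⟩ ⟨haL, hav⟩ hba : a ∈ (∅ : Set X))

/-- The cuts at the levels of `altReach` separate two points with bounded chains. -/
theorem exists_separation_of_altReach_eq_empty {C L u v : Set X} {x y : X} {n : ℕ}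
    (hC : IsClosed C) (hCL : C ⊆ closure L) (hu : u ∈ 𝓝 x) (hv : v ∈ 𝓝 y)
    (h : altReach (L ∩ u) (L ∩ v) n = ∅) :
    ∃ R B : Set X, IsClosed R ∧ IsClosed B ∧ R ∪ B = C ∧ x ∉ B ∧ y ∉ R ∧
      R ∩ B ⊆ ⋃ m ∈ Finset.range n, C ∩ (closure (L \ altReach (L ∩ u) (L ∩ v) m) ∩
        closure (L ∩ altReach (L ∩ u) (L ∩ v) m)) := by
  set H := altReach (L ∩ u) (L ∩ v)
  let D : ℕ → Set X := fun m => L ∩ (H m \ H (m + 1))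
  let LR : Set X := ⋃ m ∈ (Finset.range n).filter (fun m => ¬ Even m), D m
  let LB : Set X := ⋃ m ∈ (Finset.range n).filter (fun m => Even m), D m
  have hclR : closure LR = ⋃ m ∈ (Finset.range n).filter (fun m => ¬ Even m), closure (D m) :=
    Finset.closure_biUnion _ _
  have hclB : closure LB = ⋃ m ∈ (Finset.range n).filter (fun m => Even m), closure (D m) :=
    Finset.closure_biUnion _ _
  have hL : L ⊆ LR ∪ LB := by
    intro z hz
    classical
    have hex : ∃ m, z ∉ H m := ⟨n, by simp [h]⟩
    obtain ⟨m, hm⟩ : ∃ m, Nat.find hex = m + 1 := by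
      refine Nat.exists_eq_succ_of_ne_zero fun h0 => ?_
      have := Nat.find_spec hex
      rw [h0] at this
      exact this (mem_univ z)
    have hz1 : z ∉ H (m + 1) := hm ▸ Nat.find_spec hex
    have hz2 : z ∈ H m := not_not.1 (Nat.find_min hex (by omega))
    have hmn : m < n := by
      have : Nat.find hex ≤ n := Nat.find_min' hex (by simp [h])
      omega
    by_cases hme : Even m
    · exact Or.inr (mem_iUnion₂.2 ⟨m, Finset.mem_filter.2 ⟨Finset.mem_range.2 hmn, hme⟩, hz, hz2, hz1⟩)
    · exact Or.inl (mem_iUnion₂.2 ⟨m, Finset.mem_filter.2 ⟨Finset.mem_range.2 hmn, hme⟩, hz, hz2, hz1⟩)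
  refine ⟨C ∩ closure LR, C ∩ closure LB, hC.inter isClosed_closure, hC.inter isClosed_closure,
    ?_, ?_, ?_, ?_⟩
  · rw [← inter_union_distrib_left, ← closure_union]
    exact inter_eq_left.2 (hCL.trans (closure_mono hL))
  · rintro ⟨_, hx⟩
    obtain ⟨z, hzu, hz⟩ := mem_closure_iff_nhds.1 hx u hu
    obtain ⟨m, hm, hzL, hz1, hz2⟩ := mem_iUnion₂.1 hz
    have hme : Even m := (Finset.mem_filter.1 hm).2
    exact hz2 (mem_altReach_succ hz1 (by rw [if_pos hme]; exact ⟨hzL, hzu⟩))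
  · rintro ⟨_, hy⟩
    obtain ⟨z, hzv, hz⟩ := mem_closure_iff_nhds.1 hy v hv
    obtain ⟨m, hm, hzL, hz1, hz2⟩ := mem_iUnion₂.1 hz
    have hme : ¬ Even m := (Finset.mem_filter.1 hm).2
    exact hz2 (mem_altReach_succ hz1 (by rw [if_neg hme]; exact ⟨hzL, hzv⟩))
  · rintro z ⟨⟨hzC, hzR⟩, _, hzB⟩
    rw [hclR] at hzR
    rw [hclB] at hzB
    obtain ⟨i, hi, hzi⟩ := mem_iUnion₂.1 hzR
    obtain ⟨j, hj, hzj⟩ := mem_iUnion₂.1 hzB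
    simp only [Finset.mem_filter, Finset.mem_range] at hi hj
    -- The cut at the larger index `j` has `D i` below it and `D j` above it.
    have key : ∀ i j, i < j → j < n → z ∈ closure (D i) → z ∈ closure (D j) →
        z ∈ ⋃ m ∈ Finset.range n, C ∩ (closure (L \ H m) ∩ closure (L ∩ H m)) := by
      intro i j hij hjn hzi hzj
      refine mem_iUnion₂.2 ⟨j, Finset.mem_range.2 hjn, hzC, ?_, ?_⟩
      · have hsub : D i ⊆ L \ H j :=
          fun w hw => ⟨hw.1, fun hw' => hw.2.2 (altReach_antitone hij hw')⟩
        exact closure_mono hsub hzi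
      · have hsub : D j ⊆ L ∩ H j := fun w hw => ⟨hw.1, hw.2.1⟩
        exact closure_mono hsub hzj
    rcases lt_trichotomy i j with hij | rfl | hij
    · exact key i j hij hj.1 hzi hzj
    · exact absurd hj.2 hi.2
    · exact key j i hij hi.1 hzj hzi

/-- In the inductive step, each boundary piece becomes the new `C`, and the part of `L` below the
cut becomes the new `L`. -/
theorem NoLongChain.coverMultLE [CompactSpace X] [T2Space X] {C L : Set X} {n : ℕ}
    (h : NoLongChain C L (n + 2)) (hC : IsClosed C) (hCL : C ⊆ closure L) :
    CoverMultLE C (n + 1) := by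
  induction n generalizing C L with
  | zero => exact CoverMultLE.of_subsingleton (h.subsingleton hCL)
  | succ n ih =>
    refine CoverMultLE.succ_of_separation hC.isCompact fun x hx y hy hxy => ?_
    obtain ⟨u, hu, v, hv, huv⟩ := h x hx y hy hxy
    obtain ⟨R, B, hR, hB, hRB, hxB, hyR, hsub⟩ :=
      exists_separation_of_altReach_eq_empty hC hCL hu hv huv
    have hcl : ∀ S : Set X, IsClosed (C ∩ (closure (L \ S) ∩ closure (L ∩ S))) := fun S =>
      hC.inter (isClosed_closure.inter isClosed_closure)
    refine ⟨R, B, hR, hB, hRB, hxB, hyR, CoverMultLE.mono ?_ (hR.inter hB) hsub⟩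
    exact CoverMultLE.biUnion _
      (fun m _ => ih (h.boundary (isUpperSet_altReach m)) (hcl _)
        (inter_subset_right.trans inter_subset_left))
      (fun m _ => hcl _)

end Reach

/-! ### Back to covering dimension and snakes -/

theorem CoverMultLE.hasCoveringDimLE {X : Type u} [TopologicalSpace X] {n : ℕ}
    (h : CoverMultLE (univ : Set X) (n + 1)) : HasCoveringDimLE X (n : WithBot ℕ∞) := by
  rintro A ⟨hA, hAo, hAc⟩
  have := hA.to_subtype
  obtain ⟨V, hV, hVU, hVc, hm⟩ := h A (fun U => U) (fun U => hAo U U.2)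
    (by rw [← sUnion_eq_iUnion, hAc])
  refine ⟨range V, ⟨finite_range V, ?_, ?_⟩, ?_, ?_⟩
  · rintro _ ⟨i, rfl⟩
    exact hV i
  · rw [sUnion_range]
    exact univ_subset_iff.1 hVc
  · rintro _ ⟨i, rfl⟩
    exact ⟨i, i.2, hVU i⟩
  · refine iSup₂_le ?_
    rintro m ⟨F, hF, hcard, x, hx⟩
    -- Distinct sets have distinct indices, so counting members is bounded by counting indices.
    have hle : F.card ≤ {i | x ∈ V i}.ncard := by
      have hsub : (F : Set (Set X)) ⊆ V '' {i | x ∈ V i} := by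
        intro S hS
        obtain ⟨i, rfl⟩ := hF hS
        exact ⟨i, hx _ hS, rfl⟩
      rw [← ncard_coe_finset]
      exact (ncard_le_ncard hsub (toFinite _)).trans (ncard_image_le (toFinite _))
    have hmn : m ≤ n := by
      have := hm x (mem_univ x)
      omega
    exact_mod_cast hmn

theorem exists_not_containsSnake {M : Type*} [MetricSpace M] {T : LinearOrder M} {s : ℕ}
    (h : snakeNumber M T ≤ (s : ℕ∞)) {x y : M} (hxy : x ≠ y) :
    ∃ ε > 0, ¬ ContainsSnake T (Metric.ball x ε) (Metric.ball y ε) (s + 1) := by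
  by_contra! hc
  have h1 : ((s + 1 : ℕ) : ℕ∞) ≤ pairSnakeNumber T x y :=
    le_iSup₂_of_le (s + 1) hc le_rfl
  have h2 : pairSnakeNumber T x y ≤ snakeNumber M T :=
    le_iSup_of_le x (le_iSup₂_of_le y hxy le_rfl)
  have h3 := (h1.trans h2).trans h
  rw [Nat.cast_le] at h3
  omega

theorem noLongChain_of_snakeNumber_le {M : Type*} [MetricSpace M] [T : LinearOrder M] {s : ℕ}
    (h : snakeNumber M T ≤ (s : ℕ∞)) : NoLongChain (univ : Set M) univ (s + 2) := by
  intro x _ y _ hxy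
  obtain ⟨ε, hε, hsnake⟩ := exists_not_containsSnake h hxy
  -- Radii at most half the distance make the balls disjoint, so a chain of `s + 2` points is strict
  -- and is a snake of length `s + 1`.
  have hd : 0 < dist x y / 2 := half_pos (dist_pos.2 hxy)
  refine ⟨Metric.ball x (min ε (dist x y / 2)), Metric.ball_mem_nhds x (lt_min hε hd),
    Metric.ball y (min ε (dist x y / 2)), Metric.ball_mem_nhds y (lt_min hε hd),
    eq_empty_iff_forall_notMem.2 fun z hz => hsnake ?_⟩
  rw [univ_inter, univ_inter] at hz
  have hdisj : Disjoint (Metric.ball x (min ε (dist x y / 2)))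
      (Metric.ball y (min ε (dist x y / 2))) :=
    Metric.ball_disjoint_ball (by linarith [min_le_right ε (dist x y / 2)])
  obtain ⟨a, ha, hPQ, _⟩ := exists_chain_of_mem_altReach hdisj hz
  have hlt : ∀ i j, i < j → j ≤ s + 1 → a i < a j := by
    intro i j hij
    induction j, hij using Nat.le_induction with
    | base => exact fun hj => ha i hj
    | succ j _ ih => exact fun hj => (ih (by omega)).trans (ha j hj)
  refine ⟨fun i => a i, fun i j hij => hlt i j hij (by omega), fun i hi => ?_, fun i hi => ?_⟩
  · have := hPQ i (by omega)
    rw [if_pos hi] at this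
    exact Metric.ball_subset_ball (min_le_left _ _) this
  · have := hPQ i (by omega)
    rw [if_neg (Nat.not_even_iff_odd.2 hi)] at this
    exact Metric.ball_subset_ball (min_le_left _ _) this

theorem theorem2 {M : Type*} [MetricSpace M] [CompactSpace M] (T : LinearOrder M) (s : ℕ)
    (h : snakeNumber M T ≤ (s : ℕ∞)) : coveringDim M ≤ (s : WithBot ℕ∞) := by
  rw [coveringDim_le_iff]
  exact ((noLongChain_of_snakeNumber_le h).coverMultLE isClosed_univ (by simp)).hasCoveringDimLE
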